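/- Let $\|\cdot\|$ denote the Frobenius norm on complex matrices. For every complex square matrix $A$, every real $\epsilon>0$ and every real $r$ with $0<r<1$, there is a complex matrix $E$ of the same size as $A$ such that $A+E$ is diagonalizable over $\mathbb{C}$ (that is, $P(A+E)P^{-1}$ is diagonal for some invertible complex matrix $P$) and, for all integers $n\ge 0$, $$\|(A+E)^n-A^n\|\le r^n\epsilon \quad\text{if } A \text{ is nilpotent},$$ $$\frac{\|(A+E)^n-A^n\|}{\|A^n\|}\le n\epsilon \quad\text{otherwise}.$$ -/

import Mathlib

-- Throughout, the norm of a matrix is the Frobenius norm, the square root of the sum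
-- of the squared absolute values of its entries.
attribute [local instance] Matrix.frobeniusNormedAddCommGroup

/-- A complex square matrix `M` is diagonalizable over `ℂ` if `P * M * P⁻¹` is a diagonal
matrix for some invertible complex matrix `P`. -/
def IsDiagonalizableMatrix {ι : Type*} [Fintype ι] [DecidableEq ι] (M : Matrix ι ι ℂ) : Prop :=
  ∃ P : (Matrix ι ι ℂ)ˣ,
    ((P : Matrix ι ι ℂ) * M * ((P⁻¹ : (Matrix ι ι ℂ)ˣ) : Matrix ι ι ℂ)).IsDiag

/-!
A diagonalizable `A + E` all of whose powers stay close to those of `A` is found one generalized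
eigenspace at a time, without the Jordan normal form.

On the generalized eigenspace of `μ` the operator is `μ + N` with `N` nilpotent of some index `k`.
A basis adapted to the flag `ker N ⊆ ker N ^ 2 ⊆ ⋯` gives every basis vector a level `< k`, and `N`
strictly changes levels in one direction (`exists_basis_raises_level`). Adding to `μ + N` a diagonal
matrix that depends injectively on the level produces `k` distinct diagonal scalars, and the
resulting matrix is annihilated by the product of the `k` corresponding linear factors, hence is
diagonalizable (`isSimplySplit_diagonal_add`). It remains to choose the scalars well.

* If `μ ≠ 0`, rescale to `μ = 1` and use the scalars `1 - δ * m` with `m` the level. Let `D` be the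
  diagonal part. In the expansion of `(D + N) ^ n` only words with fewer than `k` letters `N`
  survive, and since `D` is a contraction near the identity, the words with `d` letters `N` differ
  from `n.choose d • N ^ d` by `O(n δ (n.choose d))` (`norm_wordSum_sub_le`). As
  `1, N, …, N ^ (k - 1)` are linearly independent, `∑ d < k, n.choose d` is `O(‖(1 + N) ^ n‖)`, so
  the total error is at most `ε * n * ‖(1 + N) ^ n‖` (`hasSplitPowerApprox_one_add`). Keeping the
  scalars inside the unit disc is what makes this uniform in `n`.
* If `μ = 0`, a diagonal conjugation makes `N` as small as desired, and the telescoping estimate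
  for `b ^ n - a ^ n` gives an error `ε * n * r ^ n` (`hasSplitPowerApprox_of_raises_level`).

Both estimates are instances of `HasSplitPowerApprox`, which is insensitive to the choice of norm,
passes through injective algebra homomorphisms and finite products, and therefore holds for every
matrix (`Matrix.hasSplitPowerApprox`). If `A` is not nilpotent, it has an eigenvalue `μ ≠ 0` and
`‖A ^ n‖ ≥ ‖μ‖ ^ n`, so with `r = ‖μ‖` the term `r ^ n` is dominated by `‖A ^ n‖`. If `A` is
nilpotent, the term `‖A ^ n‖` vanishes for large `n` and the rate `r / 2` absorbs the factor `n`.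
-/

section

open Polynomial

/-! ### Perturbations in complex algebras -/

/-- An element of a complex algebra is *simply split* if it is annihilated by a product of
distinct linear factors. For matrices this is diagonalizability, but it makes sense in every
algebra and is visibly preserved by algebra homomorphisms. -/
def IsSimplySplit {R : Type*} [Ring R] [Algebra ℂ R] (a : R) : Prop :=
  ∃ S : Finset ℂ, aeval a (∏ c ∈ S, (X - C c)) = 0

/-- `a` can be perturbed by arbitrarily small relative amounts to a simply split element, with
control on all powers at once. The summand `r ^ n` absorbs the nilpotent part of `a`, whose powers
eventually vanish. -/
def HasSplitPowerApprox {R : Type*} [NormedRing R] [NormedAlgebra ℂ R] (r : ℝ) (a : R) : Prop :=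
  ∀ ε : ℝ, 0 < ε → ∃ e : R, IsSimplySplit (a + e) ∧
    ∀ n : ℕ, ‖(a + e) ^ n - a ^ n‖ ≤ ε * n * (‖a ^ n‖ + r ^ n)

theorem aeval_prod_X_sub_C_eq_zero_of_subset {R : Type*} [Ring R] [Algebra ℂ R] {a : R}
    {S T : Finset ℂ} (h : S ⊆ T) (hS : aeval a (∏ c ∈ S, (X - C c)) = 0) :
    aeval a (∏ c ∈ T, (X - C c)) = 0 := by
  rw [← Finset.prod_sdiff h, map_mul, hS, mul_zero]

theorem IsSimplySplit.map {R R' : Type*} [Ring R] [Algebra ℂ R] [Ring R'] [Algebra ℂ R'] {a : R}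
    (h : IsSimplySplit a) (φ : R →ₐ[ℂ] R') : IsSimplySplit (φ a) := by
  obtain ⟨S, hS⟩ := h
  exact ⟨S, by rw [aeval_algHom_apply, hS, map_zero]⟩

theorem IsSimplySplit.pi {I : Type*} [Fintype I] {R : I → Type*} [∀ i, Ring (R i)]
    [∀ i, Algebra ℂ (R i)] {a : ∀ i, R i} (h : ∀ i, IsSimplySplit (a i)) : IsSimplySplit a := by
  choose S hS using h
  refine ⟨Finset.univ.biUnion S, funext fun i => ?_⟩
  have h1 := aeval_algHom_apply (Pi.evalAlgHom ℂ R i) a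
    (∏ c ∈ Finset.univ.biUnion S, (X - C c))
  have h2 := aeval_prod_X_sub_C_eq_zero_of_subset
    (Finset.subset_biUnion_of_mem S (Finset.mem_univ i)) (hS i)
  simp only [Pi.evalAlgHom_apply] at h1
  rw [← h1, h2, Pi.zero_apply]

theorem IsSimplySplit.smul {R : Type*} [Ring R] [Algebra ℂ R] {a : R} (h : IsSimplySplit a)
    {c : ℂ} (hc : c ≠ 0) : IsSimplySplit (c • a) := by
  obtain ⟨S, hS⟩ := h
  refine ⟨S.image (c * ·), ?_⟩
  rw [Finset.prod_image (fun x _ y _ hxy => mul_left_cancel₀ hc hxy)]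
  have h1 : aeval (c • a) (∏ s ∈ S, (X - C (c * s)))
      = aeval a ((∏ s ∈ S, (X - C (c * s))).comp (C c * X)) := by
    rw [aeval_comp]; simp [Algebra.smul_def]
  have h2 : (∏ s ∈ S, (X - C (c * s))).comp (C c * X) = (∏ s ∈ S, C c) * ∏ s ∈ S, (X - C s) := by
    rw [prod_comp, ← Finset.prod_mul_distrib]
    refine Finset.prod_congr rfl fun s _ => ?_
    simp; ring
  rw [h1, h2, map_mul, hS, mul_zero]

theorem HasSplitPowerApprox.map {R R' : Type*} [NormedRing R] [NormedAlgebra ℂ R]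
    [FiniteDimensional ℂ R] [NormedRing R'] [NormedAlgebra ℂ R'] {r : ℝ} (hr : 0 ≤ r) {a : R}
    (h : HasSplitPowerApprox r a) (φ : R →ₐ[ℂ] R') (hφ : Function.Injective φ) :
    HasSplitPowerApprox r (φ a) := by
  intro ε hε
  -- all norms on a finite-dimensional space are equivalent: `φ` distorts norms boundedly
  obtain ⟨K, hK, hK'⟩ := (LinearMap.toContinuousLinearMap φ.toLinearMap).bound
  obtain ⟨L, hL, hL'⟩ := LinearMap.exists_antilipschitzWith
    (LinearMap.toContinuousLinearMap φ.toLinearMap).toLinearMap (LinearMap.ker_eq_bot.2 hφ)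
  have hK1 : ∀ x, ‖φ x‖ ≤ K * ‖x‖ := hK'
  have hL1 : ∀ x, ‖x‖ ≤ L * ‖φ x‖ := fun x => by
    simpa using hL'.le_mul_norm_sub x 0
  obtain ⟨e, he, hn⟩ := h (ε / (K * (L + 1))) (by positivity)
  refine ⟨φ e, by simpa using he.map φ, fun n => ?_⟩
  have h1 : (φ a + φ e) ^ n - φ a ^ n = φ ((a + e) ^ n - a ^ n) := by simp
  rw [h1, ← map_pow]
  have hL0 : (0:ℝ) ≤ L := L.2
  have hrn : 0 ≤ r ^ n := pow_nonneg hr n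
  calc ‖φ ((a + e) ^ n - a ^ n)‖ ≤ K * ‖(a + e) ^ n - a ^ n‖ := hK1 _
    _ ≤ K * (ε / (K * (L + 1)) * n * (‖a ^ n‖ + r ^ n)) := by gcongr; exact hn n
    _ ≤ K * (ε / (K * (L + 1)) * n * ((L + 1) * (‖φ (a ^ n)‖ + r ^ n))) := by
        gcongr
        nlinarith [hL1 (a ^ n), norm_nonneg (φ (a ^ n)), mul_nonneg hL0 hrn]
    _ = ε * n * (‖φ (a ^ n)‖ + r ^ n) := by field_simp

theorem HasSplitPowerApprox.pi {I : Type*} [Fintype I] {R : I → Type*} [∀ i, NormedRing (R i)]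
    [∀ i, NormedAlgebra ℂ (R i)] {r : ℝ} (hr : 0 ≤ r) {a : ∀ i, R i}
    (h : ∀ i, HasSplitPowerApprox r (a i)) : HasSplitPowerApprox r a := by
  intro ε hε
  choose e he hn using fun i => h i ε hε
  refine ⟨e, IsSimplySplit.pi he, fun n => ?_⟩
  have hrn : 0 ≤ r ^ n := pow_nonneg hr n
  rw [pi_norm_le_iff_of_nonneg (by positivity)]
  intro i
  refine (hn i n).trans ?_
  gcongr
  exact norm_le_pi_norm (a ^ n) i

theorem HasSplitPowerApprox.smul {R : Type*} [NormedRing R] [NormedAlgebra ℂ R] {r : ℝ} {a : R}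
    {c : ℂ} (hc : c ≠ 0) (h : HasSplitPowerApprox (r / ‖c‖) a) :
    HasSplitPowerApprox r (c • a) := by
  intro ε hε
  obtain ⟨e, he, hn⟩ := h ε hε
  refine ⟨c • e, by simpa using he.smul hc, fun n => ?_⟩
  have hc' : 0 < ‖c‖ ^ n := pow_pos (norm_pos_iff.2 hc) n
  rw [← smul_add, _root_.smul_pow, _root_.smul_pow, ← smul_sub, norm_smul, norm_smul, norm_pow]
  calc ‖c‖ ^ n * ‖(a + e) ^ n - a ^ n‖
      ≤ ‖c‖ ^ n * (ε * n * (‖a ^ n‖ + (r / ‖c‖) ^ n)) := by gcongr; exact hn n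
    _ = ε * n * (‖c‖ ^ n * ‖a ^ n‖ + r ^ n) := by rw [div_pow]; field_simp

/-! ### Expanding powers of a sum of two non-commuting elements -/

/-- `wordSum D N n d` is the sum of all words of length `n` in `D` and `N` in which `N` occurs
exactly `d` times. -/
def wordSum {R : Type*} [Ring R] (D N : R) : ℕ → ℕ → R
  | 0, 0 => 1
  | 0, _ + 1 => 0
  | n + 1, 0 => D * wordSum D N n 0
  | n + 1, d + 1 => D * wordSum D N n (d + 1) + N * wordSum D N n d

theorem add_pow_eq_sum_wordSum {R : Type*} [Ring R] (D N : R) (n : ℕ) :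
    ∀ K, n < K → (D + N) ^ n = ∑ d ∈ Finset.range K, wordSum D N n d := by
  induction n with
  | zero =>
    intro K hK
    obtain ⟨K, rfl⟩ : ∃ L, K = L + 1 := ⟨K - 1, by omega⟩
    rw [Finset.sum_range_succ']
    simp [wordSum]
  | succ n ih =>
    intro K hK
    obtain ⟨K, rfl⟩ : ∃ L, K = L + 1 := ⟨K - 1, by omega⟩
    rw [Finset.sum_range_succ']
    simp only [wordSum]
    rw [Finset.sum_add_distrib, ← Finset.mul_sum, ← Finset.mul_sum, ← ih K (by omega),
      add_right_comm, ← mul_add, ← Finset.sum_range_succ' (fun d => wordSum D N n d),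
      ← ih (K + 1) (by omega), pow_succ', add_mul]

theorem wordSum_eq_zero_of_lt {R : Type*} [Ring R] (D N : R) (n : ℕ) :
    ∀ d, n < d → wordSum D N n d = 0 := by
  induction n with
  | zero =>
    intro d hd
    obtain ⟨d, rfl⟩ : ∃ L, d = L + 1 := ⟨d - 1, by omega⟩
    rfl
  | succ n ih =>
    intro d hd
    obtain ⟨d, rfl⟩ : ∃ L, d = L + 1 := ⟨d - 1, by omega⟩
    simp [wordSum, ih d (by omega), ih (d + 1) (by omega)]

theorem wordSum_one_left {R : Type*} [Ring R] (N : R) (n : ℕ) :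
    ∀ d, wordSum 1 N n d = (n.choose d : R) * N ^ d := by
  induction n with
  | zero => rintro (_ | d) <;> simp [wordSum]
  | succ n ih =>
    rintro (_ | d)
    · simp [wordSum, ih]
    · simp only [wordSum, ih, one_mul, Nat.choose_succ_succ, Nat.cast_add]
      rw [← mul_assoc, ← (Nat.cast_commute _ N).eq, mul_assoc, ← pow_succ', add_mul, add_comm]

theorem norm_pow_le_pow_mul_norm_one {R : Type*} [NormedRing R] (a : R) (n : ℕ) :
    ‖a ^ n‖ ≤ ‖a‖ ^ n * ‖(1 : R)‖ := by
  induction n with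
  | zero => simp
  | succ n ih =>
    calc ‖a ^ (n + 1)‖ ≤ ‖a‖ * ‖a ^ n‖ := by rw [pow_succ']; exact norm_mul_le _ _
      _ ≤ ‖a‖ * (‖a‖ ^ n * ‖(1 : R)‖) := by gcongr
      _ = _ := by ring

/-- If left multiplication by `D` is a contraction close to the identity, then replacing `1` by `D`
changes each homogeneous part of `(1 + N) ^ n` by at most `n * δ` times its natural size. -/
theorem norm_wordSum_sub_le {R : Type*} [NormedRing R] (D N : R) {δ : ℝ} (hδ : 0 ≤ δ)
    (hD : ∀ x, ‖D * x‖ ≤ ‖x‖) (hD1 : ∀ x, ‖(D - 1) * x‖ ≤ δ * ‖x‖) (n : ℕ) :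
    ∀ d, ‖wordSum D N n d - wordSum 1 N n d‖
      ≤ n * δ * (n.choose d * (‖N‖ ^ d * ‖(1 : R)‖)) := by
  have hQ : ∀ m d : ℕ, ‖wordSum 1 N m d‖ ≤ m.choose d * (‖N‖ ^ d * ‖(1 : R)‖) := fun m d => by
    rw [wordSum_one_left, ← nsmul_eq_mul]
    refine (norm_nsmul_le).trans ?_
    gcongr
    exact norm_pow_le_pow_mul_norm_one N d
  have hstep : ∀ x y : R, ‖D * x - y‖ ≤ ‖x - y‖ + δ * ‖y‖ := fun x y => by
    calc ‖D * x - y‖ = ‖D * (x - y) + (D - 1) * y‖ := by congr 1; noncomm_ring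
      _ ≤ _ := (norm_add_le _ _).trans (add_le_add (hD _) (hD1 _))
  induction n with
  | zero => rintro (_ | d) <;> simp [wordSum]
  | succ n ih =>
    rintro (_ | d)
    · simp only [wordSum, one_mul]
      refine (hstep _ _).trans ?_
      have h1 := ih 0
      have h2 := mul_le_mul_of_nonneg_left (hQ n 0) hδ
      simp only [Nat.choose_zero_right, Nat.cast_one, one_mul, pow_zero, Nat.cast_add] at h1 h2 ⊢
      linarith
    · simp only [wordSum, one_mul]
      have h1 := ih (d + 1)
      have h2 := mul_le_mul_of_nonneg_left (hQ n (d + 1)) hδ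
      have h3 : ‖N * (wordSum D N n d - wordSum 1 N n d)‖
          ≤ ‖N‖ * (n * δ * (n.choose d * (‖N‖ ^ d * ‖(1 : R)‖))) :=
        (norm_mul_le _ _).trans (by gcongr; exact ih d)
      have h4 : 0 ≤ δ * (n.choose d * (‖N‖ ^ (d + 1) * ‖(1 : R)‖)) := by positivity
      calc ‖D * wordSum D N n (d + 1) + N * wordSum D N n d
            - (wordSum 1 N n (d + 1) + N * wordSum 1 N n d)‖
          = ‖(D * wordSum D N n (d + 1) - wordSum 1 N n (d + 1))
            + N * (wordSum D N n d - wordSum 1 N n d)‖ := by congr 1; noncomm_ring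
        _ ≤ _ := (norm_add_le _ _).trans (add_le_add (hstep _ _) h3)
        _ ≤ n * δ * (n.choose (d + 1) * (‖N‖ ^ (d + 1) * ‖(1 : R)‖))
            + δ * (n.choose (d + 1) * (‖N‖ ^ (d + 1) * ‖(1 : R)‖))
            + ‖N‖ * (n * δ * (n.choose d * (‖N‖ ^ d * ‖(1 : R)‖))) := by gcongr
        _ ≤ _ := by
          rw [Nat.choose_succ_succ]
          push_cast
          rw [pow_succ] at *
          nlinarith

theorem norm_pow_sub_pow_le_of_norm_le {R : Type*} [NormedRing R] (a b : R) {s : ℝ} (hs : 0 < s)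
    (ha : ‖a‖ ≤ s) (hb : ‖b‖ ≤ s) (n : ℕ) :
    ‖b ^ n - a ^ n‖ ≤ n * (‖b - a‖ * ‖(1 : R)‖ / s) * s ^ n := by
  induction n with
  | zero => simp
  | succ n ih =>
    calc ‖b ^ (n + 1) - a ^ (n + 1)‖ = ‖b * (b ^ n - a ^ n) + (b - a) * a ^ n‖ := by
          rw [pow_succ', pow_succ']; congr 1; noncomm_ring
      _ ≤ ‖b‖ * ‖b ^ n - a ^ n‖ + ‖b - a‖ * ‖a ^ n‖ :=
          (norm_add_le _ _).trans (add_le_add (norm_mul_le _ _) (norm_mul_le _ _))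
      _ ≤ s * (n * (‖b - a‖ * ‖(1 : R)‖ / s) * s ^ n) + ‖b - a‖ * (s ^ n * ‖(1 : R)‖) := by
          gcongr
          exact (norm_pow_le_pow_mul_norm_one a n).trans (by gcongr)
      _ = _ := by push_cast; field_simp; ring

/-! ### Matrices that strictly raise a level function -/

section Level

variable {κ : Type*} [Fintype κ] [DecidableEq κ] {lev : κ → ℕ} {N : Matrix κ κ ℂ}

theorem wordSum_diagonal_apply_eq_zero (hN : ∀ i j, lev j ≤ lev i → N i j = 0) (v : κ → ℂ)
    (n : ℕ) : ∀ (d : ℕ) (i j : κ), lev j < lev i + d →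
      wordSum (Matrix.diagonal v) N n d i j = 0 := by
  induction n with
  | zero =>
    rintro (_ | d) i j h
    · have : i ≠ j := by rintro rfl; omega
      simp [wordSum, this]
    · rfl
  | succ n ih =>
    rintro (_ | d) i j h
    · simp [wordSum, ih 0 i j h]
    · rw [wordSum, Matrix.add_apply, Matrix.diagonal_mul, ih (d + 1) i j h, mul_zero,
        zero_add, Matrix.mul_apply]
      refine Finset.sum_eq_zero fun l _ => ?_
      rcases le_or_gt (lev l) (lev i) with h1 | h1
      · rw [hN i l h1, zero_mul]
      · rw [ih d l j (by omega), mul_zero]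

theorem diagonal_add_pow_eq_sum {k : ℕ} (hN : ∀ i j, lev j ≤ lev i → N i j = 0)
    (hk : ∀ i, lev i < k) (v : κ → ℂ) (n : ℕ) :
    (Matrix.diagonal v + N) ^ n = ∑ d ∈ Finset.range k, wordSum (Matrix.diagonal v) N n d := by
  rw [add_pow_eq_sum_wordSum _ _ n (n + 1 + k) (by omega)]
  refine (Finset.sum_subset (by intro x; simp; omega) fun d _ hd => ?_).symm
  ext i j
  have := hk j
  exact wordSum_diagonal_apply_eq_zero hN v n d i j (by simp at hd; omega)

/-- Distinct scalars on distinct levels make a level-raising matrix simply split: each factor of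
the product pushes the columns one level further down. -/
theorem isSimplySplit_diagonal_add (hN : ∀ i j, lev j ≤ lev i → N i j = 0) {c : ℕ → ℂ}
    (hc : Function.Injective c) :
    IsSimplySplit (Matrix.diagonal (fun i => c (lev i)) + N) := by
  set B := Matrix.diagonal (fun i => c (lev i)) + N with hB
  have key : ∀ (m : ℕ) (i j : κ), lev j < m →
      (aeval B (∏ l ∈ Finset.range m, (X - C (c l)))) i j = 0 := by
    intro m
    induction m with
    | zero => intro i j h; omega
    | succ m ih =>
      intro i j h
      rw [Finset.prod_range_succ, map_mul, Matrix.mul_apply]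
      refine Finset.sum_eq_zero fun l _ => ?_
      by_cases hl : lev l < m
      · rw [ih i l hl, zero_mul]
      · have h1 : (aeval B (X - C (c m))) l j = 0 := by
          simp only [map_sub, aeval_X, aeval_C, Matrix.sub_apply, hB, Matrix.add_apply,
            hN l j (by omega), Matrix.algebraMap_matrix_apply, Matrix.diagonal_apply, add_zero]
          split_ifs with hlj
          · subst hlj
            have : lev l = m := by omega
            simp [this]
          · simp
        rw [h1, mul_zero]
  refine ⟨(Finset.range (Finset.univ.sup lev + 1)).image c, ?_⟩
  rw [Finset.prod_image hc.injOn]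
  ext i j
  exact key _ i j (Nat.lt_succ_of_le (Finset.le_sup (f := lev) (Finset.mem_univ j)))

end Level

/-! ### Perturbing a single generalized eigenspace -/

attribute [local instance] Matrix.frobeniusNormedSpace Matrix.frobeniusNormedRing
  Matrix.frobeniusNormedAlgebra

section Block

variable {κ : Type*} [Fintype κ] [DecidableEq κ]

theorem frobenius_norm_diagonal_mul_le {v : κ → ℂ} {c : ℝ} (hc : 0 ≤ c) (hv : ∀ i, ‖v i‖ ≤ c)
    (M : Matrix κ κ ℂ) : ‖Matrix.diagonal v * M‖ ≤ c * ‖M‖ := by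
  have h : ‖Matrix.diagonal v * M‖ ≤ ‖(c : ℂ) • M‖ := by
    rw [Matrix.frobenius_norm_def, Matrix.frobenius_norm_def]
    gcongr with i _ j _
    rw [Matrix.diagonal_mul, Matrix.smul_apply, norm_mul, norm_smul, Complex.norm_real,
      Real.norm_of_nonneg hc]
    gcongr
    exact hv i
  rwa [norm_smul, Complex.norm_real, Real.norm_of_nonneg hc] at h

variable {lev : κ → ℕ} {N : Matrix κ κ ℂ} {k : ℕ}

/-- Linear independence of the powers of `N` prevents cancellation in the binomial expansion of
`(1 + N) ^ n`. -/
theorem exists_sum_choose_le_mul_norm_one_add_pow (hN : ∀ i j, lev j ≤ lev i → N i j = 0)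
    (hk : ∀ i, lev i < k) (hli : LinearIndependent ℂ (fun d : Fin k => N ^ (d : ℕ))) :
    ∃ K : ℝ, 0 ≤ K ∧
      ∀ n : ℕ, ∑ d ∈ Finset.range k, (n.choose d : ℝ) ≤ K * ‖(1 + N) ^ n‖ := by
  let φ : (Fin k → ℂ) →ₗ[ℂ] Matrix κ κ ℂ := Fintype.linearCombination ℂ (fun d => N ^ (d : ℕ))
  obtain ⟨L, -, hL⟩ := LinearMap.exists_antilipschitzWith φ
    (LinearMap.ker_eq_bot.2 hli.fintypeLinearCombination_injective)
  refine ⟨k * L, by positivity, fun n => ?_⟩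
  have h1 : (1 + N) ^ n = φ (fun d => (n.choose d : ℂ)) := by
    have := diagonal_add_pow_eq_sum hN hk (fun _ => 1) n
    rw [Matrix.diagonal_one] at this
    rw [this, Fintype.linearCombination_apply, Finset.sum_range]
    refine Finset.sum_congr rfl fun d _ => ?_
    rw [wordSum_one_left, Nat.cast_smul_eq_nsmul, nsmul_eq_mul]
  have h2 : ‖(fun d : Fin k => (n.choose d : ℂ))‖ ≤ L * ‖(1 + N) ^ n‖ := by
    simpa [h1] using hL.le_mul_norm_sub (fun d : Fin k => (n.choose d : ℂ)) 0
  rw [Finset.sum_range]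
  calc ∑ d : Fin k, (n.choose d : ℝ) ≤ ∑ _d : Fin k, (L * ‖(1 + N) ^ n‖ : ℝ) := by
        refine Finset.sum_le_sum fun d _ => le_trans ?_ h2
        simpa using norm_le_pi_norm (fun d : Fin k => (n.choose d : ℂ)) d
    _ = k * L * ‖(1 + N) ^ n‖ := by simp; ring

/-- The eigenvalue `1` is spread over the distinct values `1 - δ * m` inside the unit disc, so no
power grows faster than before. -/
theorem hasSplitPowerApprox_one_add (hN : ∀ i j, lev j ≤ lev i → N i j = 0)
    (hk : ∀ i, lev i < k) (hli : LinearIndependent ℂ (fun d : Fin k => N ^ (d : ℕ)))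
    {r : ℝ} (hr : 0 ≤ r) : HasSplitPowerApprox r (1 + N) := by
  intro ε hε
  obtain ⟨K, hK0, hK⟩ := exists_sum_choose_le_mul_norm_one_add_pow hN hk hli
  set a : ℝ := max 1 ‖N‖
  set o : ℝ := ‖(1 : Matrix κ κ ℂ)‖
  have ha : 1 ≤ a := le_max_left _ _
  -- `δ` is the reciprocal of a sum of terms, one for each of the required upper bounds
  obtain ⟨δ, hδ0, hδ1, hδε⟩ : ∃ δ : ℝ, 0 < δ ∧ δ * k ≤ 1 ∧ δ * k * (a ^ k * o * K) ≤ ε := by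
    have hpos : 0 < 1 + k + k * (a ^ k * o * K) / ε := by positivity
    refine ⟨(1 + k + k * (a ^ k * o * K) / ε)⁻¹, by positivity, ?_, ?_⟩
    · rw [inv_mul_le_iff₀ hpos]
      have : 0 ≤ k * (a ^ k * o * K) / ε := by positivity
      linarith
    · rw [mul_assoc, inv_mul_le_iff₀ hpos]
      have : (k * (a ^ k * o * K) / ε) * ε = k * (a ^ k * o * K) := by field_simp
      have : 0 ≤ (1 + k : ℝ) * ε := by positivity
      linarith
  let c : ℕ → ℂ := fun m => ((1 - δ * m : ℝ) : ℂ)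
  have hc : Function.Injective c := fun m m' h => by
    simpa [c, hδ0.ne'] using h
  let D : Matrix κ κ ℂ := Matrix.diagonal (fun i => c (lev i))
  have hlev : ∀ i, δ * lev i ≤ δ * k := fun i => by gcongr; exact (hk i).le
  have hlev0 : ∀ i, 0 ≤ δ * lev i := fun i => by positivity
  have hD : ∀ x, ‖D * x‖ ≤ ‖x‖ := fun x => by
    have := frobenius_norm_diagonal_mul_le (v := fun i => c (lev i)) zero_le_one (fun i => by
      rw [Complex.norm_real, Real.norm_of_nonneg (by linarith [hlev i])]
      linarith [hlev0 i]) x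
    rwa [one_mul] at this
  have hD1 : ∀ x, ‖(D - 1) * x‖ ≤ δ * k * ‖x‖ := fun x => by
    have h1 : D - 1 = Matrix.diagonal (fun i => ((-(δ * lev i) : ℝ) : ℂ)) := by
      rw [← Matrix.diagonal_one, Matrix.diagonal_sub]
      congr 1; ext i; simp [c]
    rw [h1]
    exact frobenius_norm_diagonal_mul_le (by positivity) (fun i => by
      rw [Complex.norm_real, norm_neg, Real.norm_of_nonneg (hlev0 i)]
      exact hlev i) x
  have hsum : 1 + N + (D - 1) = D + N := by abel
  refine ⟨D - 1, by rw [hsum]; exact isSimplySplit_diagonal_add hN hc, fun n => ?_⟩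
  have h1 : (1 + N) ^ n = ∑ d ∈ Finset.range k, wordSum 1 N n d := by
    have := diagonal_add_pow_eq_sum hN hk (fun _ => 1) n
    rwa [Matrix.diagonal_one] at this
  have h2 : (D + N) ^ n = ∑ d ∈ Finset.range k, wordSum D N n d :=
    diagonal_add_pow_eq_sum hN hk _ n
  have hrn : 0 ≤ r ^ n := pow_nonneg hr n
  calc ‖(1 + N + (D - 1)) ^ n - (1 + N) ^ n‖
      = ‖∑ d ∈ Finset.range k, (wordSum D N n d - wordSum 1 N n d)‖ := by
        rw [hsum, h2, h1, Finset.sum_sub_distrib]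
    _ ≤ ∑ d ∈ Finset.range k, n * (δ * k) * (n.choose d * (a ^ k * o)) := by
        refine norm_sum_le_of_le _ fun d hd => ?_
        refine (norm_wordSum_sub_le D N (by positivity) hD hD1 n d).trans ?_
        gcongr
        calc ‖N‖ ^ d ≤ a ^ d := by gcongr; exact le_max_right _ _
          _ ≤ a ^ k := pow_le_pow_right₀ ha (Finset.mem_range.1 hd).le
    _ = n * (δ * k) * (a ^ k * o) * ∑ d ∈ Finset.range k, (n.choose d : ℝ) := by
        rw [Finset.mul_sum]
        exact Finset.sum_congr rfl fun d _ => by ring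
    _ ≤ n * (δ * k) * (a ^ k * o) * (K * ‖(1 + N) ^ n‖) := by gcongr; exact hK n
    _ = (δ * k * (a ^ k * o * K)) * n * ‖(1 + N) ^ n‖ := by ring
    _ ≤ ε * n * ‖(1 + N) ^ n‖ := by gcongr
    _ ≤ ε * n * (‖(1 + N) ^ n‖ + r ^ n) := by gcongr; linarith

/-- If `‖N‖ ≤ r / 2`, then `N` and its perturbation `N + δ • Λ`, with `Λ` the diagonal
matrix of levels, both have norm at most `r`, and telescoping bounds the difference of
their powers. -/
theorem hasSplitPowerApprox_of_norm_le (hN : ∀ i j, lev j ≤ lev i → N i j = 0)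
    {r : ℝ} (hr : 0 < r) (hNr : ‖N‖ ≤ r / 2) : HasSplitPowerApprox r N := by
  intro ε hε
  let Λ : Matrix κ κ ℂ := Matrix.diagonal (fun i => (lev i : ℂ))
  set o : ℝ := ‖(1 : Matrix κ κ ℂ)‖
  -- `δ` is the reciprocal of a sum of terms, one for each of the required upper bounds
  obtain ⟨δ, hδ0, hδ1, hδε⟩ : ∃ δ : ℝ, 0 < δ ∧ δ * ‖Λ‖ ≤ r / 2 ∧ δ * ‖Λ‖ * o / r ≤ ε := by
    have hpos : 0 < 1 + ‖Λ‖ / (r / 2) + ‖Λ‖ * o / r / ε := by positivity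
    refine ⟨(1 + ‖Λ‖ / (r / 2) + ‖Λ‖ * o / r / ε)⁻¹, by positivity, ?_, ?_⟩
    · rw [inv_mul_le_iff₀ hpos]
      have h1 : ‖Λ‖ / (r / 2) * (r / 2) = ‖Λ‖ := by field_simp
      have h2 : 0 ≤ (1 + ‖Λ‖ * o / r / ε) * (r / 2) := by positivity
      linarith
    · rw [mul_assoc, mul_div_assoc, inv_mul_le_iff₀ hpos]
      have h1 : ‖Λ‖ * o / r / ε * ε = ‖Λ‖ * o / r := by field_simp
      have h2 : 0 ≤ (1 + ‖Λ‖ / (r / 2)) * ε := by positivity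
      linarith
  have hΛ : ‖(δ : ℂ) • Λ‖ = δ * ‖Λ‖ := by
    rw [norm_smul, Complex.norm_real, Real.norm_of_nonneg hδ0.le]
  let c : ℕ → ℂ := fun m => δ * m
  have hc : Function.Injective c := fun m m' h => by
    simpa [c, hδ0.ne'] using h
  have hsplit : IsSimplySplit (N + (δ : ℂ) • Λ) := by
    have h1 : N + (δ : ℂ) • Λ = Matrix.diagonal (fun i => c (lev i)) + N := by
      rw [add_comm, ← Matrix.diagonal_smul]; rfl
    rw [h1]
    exact isSimplySplit_diagonal_add hN hc
  refine ⟨(δ : ℂ) • Λ, hsplit, fun n => ?_⟩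
  have h1 := norm_pow_sub_pow_le_of_norm_le N (N + (δ : ℂ) • Λ) hr (by linarith)
    ((norm_add_le _ _).trans (by rw [hΛ]; linarith)) n
  rw [add_sub_cancel_left, hΛ] at h1
  refine h1.trans ?_
  have hrn : 0 < r ^ n := pow_pos hr n
  calc n * (δ * ‖Λ‖ * o / r) * r ^ n ≤ n * ε * r ^ n := by gcongr
    _ ≤ ε * n * (‖N ^ n‖ + r ^ n) := by
      rw [mul_comm ε]; gcongr; linarith [norm_nonneg (N ^ n)]

/-- Conjugation by the diagonal matrix with entries `t ^ (-level)`, `t` small, makes a level-raising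
matrix as small as desired, after which a direct perturbation estimate suffices. -/
theorem hasSplitPowerApprox_of_raises_level (hN : ∀ i j, lev j ≤ lev i → N i j = 0)
    {r : ℝ} (hr : 0 < r) : HasSplitPowerApprox r N := by
  obtain ⟨t, ht0, ht1, htN⟩ : ∃ t : ℝ, 0 < t ∧ t ≤ 1 ∧ t * ‖N‖ ≤ r / 2 := by
    have hpos : 0 < 1 + ‖N‖ / (r / 2) := by positivity
    refine ⟨(1 + ‖N‖ / (r / 2))⁻¹, by positivity, ?_, ?_⟩
    · refine inv_le_one_of_one_le₀ ?_
      have : 0 ≤ ‖N‖ / (r / 2) := by positivity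
      linarith
    · rw [inv_mul_le_iff₀ hpos]
      have h1 : ‖N‖ / (r / 2) * (r / 2) = ‖N‖ := by field_simp
      linarith
  have ht : (t : ℂ) ≠ 0 := by exact_mod_cast ht0.ne'
  let P : (Matrix κ κ ℂ)ˣ :=
    { val := Matrix.diagonal (fun i => (t : ℂ) ^ lev i)
      inv := Matrix.diagonal (fun i => ((t : ℂ) ^ lev i)⁻¹)
      val_inv := by simp [Matrix.diagonal_mul_diagonal, ht]
      inv_val := by simp [Matrix.diagonal_mul_diagonal, ht] }
  let φ : Matrix κ κ ℂ ≃ₐ[ℂ] Matrix κ κ ℂ := MulSemiringAction.toAlgEquiv ℂ _ (ConjAct.toConjAct P)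
  have hφ : ∀ M, φ M = P.val * M * P.inv := fun M => rfl
  have hφ' : ∀ M, φ.symm M = P.inv * M * P.val := fun M => by
    rw [AlgEquiv.symm_apply_eq, hφ]
    simp only [← mul_assoc, Units.val_inv, one_mul]
    rw [mul_assoc, Units.val_inv, mul_one]
  set N' := φ.symm N
  have hentry : ∀ i j, N' i j = ((t : ℂ) ^ lev i)⁻¹ * N i j * (t : ℂ) ^ lev j := fun i j => by
    simp only [N', hφ', P, Matrix.mul_diagonal, Matrix.diagonal_mul]
  have hN' : ∀ i j, lev j ≤ lev i → N' i j = 0 := fun i j h => by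
    rw [hentry, hN i j h]; simp
  have hnorm : ‖N'‖ ≤ r / 2 := by
    refine le_trans ?_ htN
    have h : ‖N'‖ ≤ ‖(t : ℂ) • N‖ := by
      rw [Matrix.frobenius_norm_def, Matrix.frobenius_norm_def]
      gcongr with i _ j _
      rcases le_or_gt (lev j) (lev i) with h | h
      · rw [hN' i j h, norm_zero]; positivity
      · obtain ⟨m, hm⟩ := Nat.exists_eq_add_of_lt h
        have h1 : N' i j = (t : ℂ) ^ (m + 1) * N i j := by
          rw [hentry, hm, add_assoc, pow_add _ (lev i)]
          field_simp
        rw [h1, Matrix.smul_apply, norm_mul, norm_smul, norm_pow, Complex.norm_real,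
          Real.norm_of_nonneg ht0.le]
        gcongr
        exact pow_le_of_le_one ht0.le ht1 (by omega)
    rwa [norm_smul, Complex.norm_real, Real.norm_of_nonneg ht0.le] at h
  have := (hasSplitPowerApprox_of_norm_le hN' hr hnorm).map hr.le φ.toAlgHom φ.injective
  simpa [N'] using this

theorem hasSplitPowerApprox_scalar_add (hN : ∀ i j, lev j ≤ lev i → N i j = 0)
    (hk : ∀ i, lev i < k) (hli : LinearIndependent ℂ (fun d : Fin k => N ^ (d : ℕ)))
    {r : ℝ} (hr : 0 < r) (μ : ℂ) : HasSplitPowerApprox r (algebraMap ℂ _ μ + N) := by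
  by_cases hμ : μ = 0
  · simpa [hμ] using hasSplitPowerApprox_of_raises_level hN hr
  · have h1 : algebraMap ℂ _ μ + N = μ • (1 + μ⁻¹ • N) := by
      rw [smul_add, smul_smul, mul_inv_cancel₀ hμ, one_smul, Algebra.algebraMap_eq_smul_one]
    rw [h1]
    refine HasSplitPowerApprox.smul hμ (hasSplitPowerApprox_one_add (lev := lev) (k := k)
      (fun i j h => by simp [hN i j h]) hk ?_ (by positivity))
    have h2 := hli.units_smul (fun d : Fin k => (Units.mk0 μ⁻¹ (inv_ne_zero hμ)) ^ (d : ℕ))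
    convert h2 using 2 with d
    simp [_root_.smul_pow, Units.smul_def]

end Block

/-! ### Bases adapted to the kernel filtration -/

section Adapted

variable {V : Type*} [AddCommGroup V] [Module ℂ V]

theorem exists_linearIndepOn_adapted_to_filtration {F : ℕ → Submodule ℂ V} (hF : Monotone F)
    (k : ℕ) : ∃ S : Set V, S ⊆ F k ∧ LinearIndepOn ℂ id S ∧
      ∀ i ≤ k, F i ≤ Submodule.span ℂ (S ∩ F i) := by
  induction k with
  | zero =>
    obtain ⟨b, hb, -, hspan, hli⟩ := exists_linearIndepOn_id_extension
      (linearIndepOn_empty ℂ (id : V → V)) (Set.empty_subset (F 0 : Set V))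
    refine ⟨b, hb, hli, fun i hi => ?_⟩
    obtain rfl : i = 0 := by omega
    rwa [Set.inter_eq_left.2 hb]
  | succ k ih =>
    obtain ⟨S, hS, hli, hspan⟩ := ih
    obtain ⟨b, hb, hSb, hspan', hli'⟩ := exists_linearIndepOn_id_extension hli
      (hS.trans (hF k.le_succ) : S ⊆ (F (k + 1) : Set V))
    refine ⟨b, hb, hli', fun i hi => ?_⟩
    rcases Nat.lt_or_eq_of_le hi with h | rfl
    · exact (hspan i (by omega)).trans (Submodule.span_mono (Set.inter_subset_inter_left _ hSb))
    · rwa [Set.inter_eq_left.2 hb]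

theorem pow_natDegree_minpoly_eq_zero {R : Type*} [Ring R] [Algebra ℂ R] {a : R}
    (ha : IsNilpotent a) : a ^ (minpoly ℂ a).natDegree = 0 := by
  obtain ⟨m, hm⟩ := ha
  have hint : IsIntegral ℂ a := ⟨X ^ m, monic_X_pow m, by simp [hm]⟩
  have hdvd : minpoly ℂ a ∣ X ^ m := minpoly.dvd ℂ a (by simp [hm])
  obtain ⟨i, -, hi⟩ := (dvd_prime_pow prime_X m).1 hdvd
  have heq : minpoly ℂ a = X ^ i :=
    eq_of_monic_of_associated (minpoly.monic hint) (monic_X_pow i) hi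
  have h0 := minpoly.aeval ℂ a
  rw [heq] at h0 ⊢
  simpa using h0

/-- In a basis adapted to the filtration by the kernels of its powers, a nilpotent endomorphism
strictly raises a level function whose range is bounded by its nilpotency index. -/
theorem exists_basis_raises_level [FiniteDimensional ℂ V] {g : Module.End ℂ V}
    (hg : IsNilpotent g) :
    ∃ (b : Module.Basis (Fin (Module.finrank ℂ V)) ℂ V) (lev : Fin (Module.finrank ℂ V) → ℕ),
      (∀ i, lev i < (minpoly ℂ g).natDegree) ∧
      ∀ i j, lev j ≤ lev i → LinearMap.toMatrixAlgEquiv b g i j = 0 := by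
  classical
  set k := (minpoly ℂ g).natDegree
  have hgk : g ^ k = 0 := pow_natDegree_minpoly_eq_zero hg
  let F : ℕ → Submodule ℂ V := fun i => LinearMap.ker (g ^ i)
  have hF : Monotone F := fun i j hij x hx => by
    obtain ⟨l, rfl⟩ := Nat.exists_eq_add_of_le hij
    simp only [F, LinearMap.mem_ker] at hx ⊢
    rw [add_comm, pow_add, Module.End.mul_apply, hx, map_zero]
  obtain ⟨S, -, hli, hspan⟩ := exists_linearIndepOn_adapted_to_filtration hF k
  have hFk : ∀ i, k ≤ i → F i = ⊤ := fun i hi => by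
    refine top_le_iff.1 (le_trans ?_ (hF hi))
    simp [F, hgk]
  have hspan' : ∀ i, F i ≤ Submodule.span ℂ (S ∩ F i) := fun i => by
    rcases le_or_gt i k with h | h
    · exact hspan i h
    · rw [hFk i h.le, ← hFk k le_rfl]; exact hspan k le_rfl
  let b₀ : Module.Basis S ℂ V := Module.Basis.mk hli (by
    have := hspan k le_rfl
    rw [hFk k le_rfl] at this
    simpa using this)
  let b := b₀.reindex (b₀.indexEquiv (Module.finBasis ℂ V))
  have hrange : Set.range b = S := by
    rw [Module.Basis.range_reindex, show (b₀ : S → V) = fun v : S => id (v : V) from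
      Module.Basis.coe_mk _ _]
    simp
  have hex : ∀ i, ∃ m, (g ^ m) (b i) = 0 := fun i => ⟨k, by rw [hgk]; rfl⟩
  have hpos : ∀ i, 0 < Nat.find (hex i) := fun i => by
    rw [Nat.find_pos]; simpa using b.ne_zero i
  have hle : ∀ i, Nat.find (hex i) ≤ k := fun i => Nat.find_min' _ (by rw [hgk]; rfl)
  -- `b i` has level `m` if it lies in the kernel of `g ^ (m + 1)` but not in that of `g ^ m`
  refine ⟨b, fun i => Nat.find (hex i) - 1, fun i => ?_, fun i j hij => ?_⟩
  · have := hpos i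
    have := hle i
    change Nat.find (hex i) - 1 < k
    omega
  · have hij' : Nat.find (hex j) ≤ Nat.find (hex i) := by
      change Nat.find (hex j) - 1 ≤ Nat.find (hex i) - 1 at hij
      have := hpos i
      have := hpos j
      omega
    set m := Nat.find (hex j) - 1 with hm
    have hmem : g (b j) ∈ F m := by
      have h1 : (g ^ (m + 1)) (b j) = 0 := by
        have h2 := Nat.find_spec (hex j)
        rwa [show Nat.find (hex j) = m + 1 by have := hpos j; omega] at h2
      simpa [F, pow_succ] using h1
    have h1 : g (b j) ∈ Submodule.span ℂ (b '' {l | b l ∈ F m}) := by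
      have h2 := hspan' m hmem
      rwa [← hrange, Set.inter_comm, ← Set.image_preimage_eq_inter_range] at h2
    rw [Module.Basis.mem_span_image] at h1
    rw [LinearMap.toMatrixAlgEquiv_apply]
    by_contra hne
    have h2 : (g ^ m) (b i) = 0 := h1 (Finsupp.mem_support_iff.2 hne)
    have h3 := Nat.find_min' (hex i) h2
    have := hpos j
    omega

theorem exists_basis_hasSplitPowerApprox [FiniteDimensional ℂ V] {f : Module.End ℂ V} {μ : ℂ}
    (hf : IsNilpotent (f - algebraMap ℂ _ μ)) {r : ℝ} (hr : 0 < r) :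
    ∃ b : Module.Basis (Fin (Module.finrank ℂ V)) ℂ V,
      HasSplitPowerApprox r (LinearMap.toMatrixAlgEquiv b f) := by
  obtain ⟨b, lev, hk, hN⟩ := exists_basis_raises_level hf
  refine ⟨b, ?_⟩
  have h1 : LinearMap.toMatrixAlgEquiv b f
      = algebraMap ℂ _ μ + LinearMap.toMatrixAlgEquiv b (f - algebraMap ℂ _ μ) := by
    rw [map_sub, AlgEquiv.commutes]; abel
  rw [h1]
  refine hasSplitPowerApprox_scalar_add hN hk ?_ hr μ
  have h2 := (linearIndependent_pow (K := ℂ) (f - algebraMap ℂ _ μ)).map'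
    (LinearMap.toMatrixAlgEquiv b).toLinearMap
    (LinearMap.ker_eq_bot.2 (LinearMap.toMatrixAlgEquiv b).injective)
  have h3 : (fun d : Fin (minpoly ℂ (f - algebraMap ℂ (Module.End ℂ V) μ)).natDegree =>
      LinearMap.toMatrixAlgEquiv b (f - algebraMap ℂ _ μ) ^ (d : ℕ))
      = fun d : Fin _ => LinearMap.toMatrixAlgEquiv b ((f - algebraMap ℂ _ μ) ^ (d : ℕ)) :=
    funext fun d => (map_pow _ _ _).symm
  rw [h3]
  exact h2

end Adapted

/-! ### Assembling the generalized eigenspaces -/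

/-- Block-diagonal matrices as an algebra homomorphism from the product of the matrix algebras. -/
def blockDiagonalAlgHom {I : Type*} [Fintype I] [DecidableEq I] (m : I → Type*)
    [∀ i, Fintype (m i)] [∀ i, DecidableEq (m i)] :
    (∀ i, Matrix (m i) (m i) ℂ) →ₐ[ℂ] Matrix (Σ i, m i) (Σ i, m i) ℂ :=
  AlgHom.ofLinearMap
    { Matrix.blockDiagonal'AddMonoidHom m m ℂ with
      map_smul' := fun c M => Matrix.blockDiagonal'_smul c M }
    Matrix.blockDiagonal'_one (fun M N => Matrix.blockDiagonal'_mul M N)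

theorem Matrix.hasSplitPowerApprox {ι : Type*} [Fintype ι] [DecidableEq ι] (A : Matrix ι ι ℂ)
    {r : ℝ} (hr : 0 < r) : HasSplitPowerApprox r A := by
  classical
  let f : Module.End ℂ (ι → ℂ) := Matrix.toLinAlgEquiv' A
  have hint : DirectSum.IsInternal (fun μ : {μ // f.maxGenEigenspace μ ≠ ⊥} =>
      f.maxGenEigenspace μ) :=
    DirectSum.isInternal_ne_bot_iff.2 <|
      DirectSum.isInternal_submodule_of_iSupIndep_of_iSup_eq_top
        f.independent_maxGenEigenspace (Module.End.iSup_maxGenEigenspace_eq_top f)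
  have hfin : {μ | f.maxGenEigenspace μ ≠ ⊥}.Finite :=
    WellFoundedGT.finite_ne_bot_of_iSupIndep f.independent_maxGenEigenspace
  let _ : Fintype {μ // f.maxGenEigenspace μ ≠ ⊥} := hfin.fintype
  have hmaps : ∀ μ, Set.MapsTo f (f.maxGenEigenspace μ) (f.maxGenEigenspace μ) :=
    f.mapsTo_maxGenEigenspace_of_comm rfl
  have hblock : ∀ μ : {μ // f.maxGenEigenspace μ ≠ ⊥}, ∃ b : Module.Basis
      (Fin (Module.finrank ℂ (f.maxGenEigenspace μ))) ℂ (f.maxGenEigenspace (μ : ℂ)),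
      HasSplitPowerApprox r (LinearMap.toMatrixAlgEquiv b (f.restrict (hmaps μ))) := fun μ => by
    refine exists_basis_hasSplitPowerApprox (μ := μ) ?_ hr
    exact f.isNilpotent_restrict_maxGenEigenspace_sub_algebraMap μ
  choose b hb using hblock
  have hinj : Function.Injective (blockDiagonalAlgHom
      (fun μ : {μ // f.maxGenEigenspace μ ≠ ⊥} =>
        Fin (Module.finrank ℂ (f.maxGenEigenspace (μ : ℂ))))) :=
    Matrix.blockDiagonal'_injective
  have h1 := (HasSplitPowerApprox.pi hr.le hb).map hr.le _ hinj
  let c := hint.collectedBasis b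
  have h2 : blockDiagonalAlgHom _ (fun μ => LinearMap.toMatrixAlgEquiv (b μ) (f.restrict (hmaps μ)))
      = LinearMap.toMatrixAlgEquiv c f :=
    (LinearMap.toMatrix_directSum_collectedBasis_eq_blockDiagonal' hint hint b b
      (fun μ => hmaps μ)).symm
  rw [h2] at h1
  let φ := (LinearMap.toMatrixAlgEquiv c).symm.trans
    (Matrix.toLinAlgEquiv' (R := ℂ) (n := ι)).symm
  have h3 := h1.map hr.le φ.toAlgHom φ.injective
  simpa [φ, f] using h3

/-! ### Diagonalizability and lower bounds on powers -/

section Final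

variable {ι : Type*} [Fintype ι] [DecidableEq ι]

theorem IsSimplySplit.isDiagonalizableMatrix {M : Matrix ι ι ℂ} (h : IsSimplySplit M) :
    IsDiagonalizableMatrix M := by
  let f : Module.End ℂ (ι → ℂ) := Matrix.toLin' M
  have hf : IsSimplySplit f := h.map (Matrix.toLinAlgEquiv' (R := ℂ) (n := ι)).toAlgHom
  obtain ⟨S, hS⟩ := hf
  have hss : f.IsSemisimple := Module.End.isSemisimple_of_squarefree_aeval_eq_zero
    (Separable.squarefree (separable_prod_X_sub_C_iff'.2 (fun _ _ _ _ h => h))) hS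
  have hspan : ⊤ ≤ Submodule.span ℂ {v : ι → ℂ | ∃ μ : ℂ, f v = μ • v} := by
    rw [← hss.iSup_eigenspace_eq_top]
    exact iSup_le fun μ v hv => Submodule.subset_span ⟨μ, Module.End.mem_eigenspace_iff.1 hv⟩
  let b₀ := Module.Basis.ofSpan hspan
  let b := b₀.reindex (b₀.indexEquiv (Pi.basisFun ℂ ι))
  have hb : ∀ i, ∃ μ : ℂ, f (b i) = μ • b i := fun i => by
    rw [Module.Basis.reindex_apply]
    exact Module.Basis.ofSpan_subset hspan (Set.mem_range_self _)
  refine ⟨⟨b.toMatrix (Pi.basisFun ℂ ι), (Pi.basisFun ℂ ι).toMatrix b,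
    Module.Basis.toMatrix_mul_toMatrix_flip _ _, Module.Basis.toMatrix_mul_toMatrix_flip _ _⟩, ?_⟩
  have h1 : LinearMap.toMatrix (Pi.basisFun ℂ ι) (Pi.basisFun ℂ ι) f = M :=
    LinearMap.toMatrix'_toLin' M
  have h2 := basis_toMatrix_mul_linearMap_toMatrix_mul_basis_toMatrix
    b (Pi.basisFun ℂ ι) b (Pi.basisFun ℂ ι) f
  rw [h1] at h2
  change (b.toMatrix (Pi.basisFun ℂ ι) * M * (Pi.basisFun ℂ ι).toMatrix b).IsDiag
  rw [h2]
  intro i j hij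
  obtain ⟨μ, hμ⟩ := hb j
  rw [LinearMap.toMatrix_apply, hμ, map_smul, Finsupp.smul_apply, Module.Basis.repr_self,
    Finsupp.single_eq_of_ne hij, smul_zero]

/-- Any nonzero eigenvalue provides such a `ρ`. -/
theorem Matrix.exists_pos_pow_le_norm_pow {A : Matrix ι ι ℂ} (hA : ¬ IsNilpotent A) :
    ∃ ρ : ℝ, 0 < ρ ∧ ∀ n : ℕ, ρ ^ n ≤ ‖A ^ n‖ := by
  let f : Module.End ℂ (ι → ℂ) := Matrix.toLinAlgEquiv' A
  obtain ⟨μ, hμ0, hμ⟩ : ∃ μ : ℂ, μ ≠ 0 ∧ f.HasEigenvalue μ := by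
    by_contra! hno
    apply hA
    have htop : f.maxGenEigenspace 0 = ⊤ := by
      rw [← top_le_iff, ← Module.End.iSup_maxGenEigenspace_eq_top f]
      refine iSup_le fun μ => ?_
      by_cases hμ : μ = 0
      · rw [hμ]
      · have h1 : ¬ f.HasUnifEigenvalue μ ⊤ := fun h => hno μ hμ (h.lt zero_lt_one)
        rw [Module.End.HasUnifEigenvalue, not_not] at h1
        rw [Module.End.maxGenEigenspace, h1]
        exact bot_le
    have h2 : f ^ Module.finrank ℂ (ι → ℂ) = 0 := by
      rw [Module.End.maxGenEigenspace_eq_genEigenspace_finrank,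
        Module.End.genEigenspace_nat, zero_smul, sub_zero] at htop
      exact LinearMap.ker_eq_top.1 htop
    refine ⟨Module.finrank ℂ (ι → ℂ), (Matrix.toLinAlgEquiv' (R := ℂ) (n := ι)).injective ?_⟩
    rw [map_pow, map_zero]
    exact h2
  obtain ⟨v, hv⟩ := hμ.exists_hasEigenvector
  refine ⟨‖μ‖, norm_pos_iff.2 hμ0, fun n => ?_⟩
  let c : Matrix ι Unit ℂ := Matrix.replicateCol Unit v
  have hc : 0 < ‖c‖ := norm_pos_iff.2 fun h => hv.2 (by
    ext i
    exact congrFun (congrFun h i) ())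
  have h1 : A ^ n * c = μ ^ n • c := by
    have h2 : (A ^ n).mulVec v = μ ^ n • v := by
      rw [← hv.pow_apply n, ← Matrix.toLinAlgEquiv'_apply, map_pow]
    rw [← Matrix.replicateCol_mulVec, h2, Matrix.replicateCol_smul]
  have h3 := Matrix.frobenius_norm_mul (A ^ n) c
  rw [h1, norm_smul, norm_pow] at h3
  exact le_of_mul_le_mul_right h3 hc

end Final

end

theorem mainTheorem1 {ι : Type*} [Fintype ι] [DecidableEq ι] (A : Matrix ι ι ℂ)
    (ε : ℝ) (hε : 0 < ε) (r : ℝ) (hr0 : 0 < r) (hr1 : r < 1) :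
    ∃ E : Matrix ι ι ℂ, IsDiagonalizableMatrix (A + E) ∧
      (IsNilpotent A → ∀ n : ℕ, ‖(A + E) ^ n - A ^ n‖ ≤ r ^ n * ε) ∧
      (¬ IsNilpotent A → ∀ n : ℕ, ‖(A + E) ^ n - A ^ n‖ / ‖A ^ n‖ ≤ n * ε) := by
  by_cases hA : IsNilpotent A
  · obtain ⟨m, hm⟩ := hA
    -- only finitely many powers of `A` are nonzero, so `n * ‖A ^ n‖` is `O(r ^ n)`
    set K : ℝ := ∑ n ∈ Finset.range m, n * ‖A ^ n‖ / r ^ n with hK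
    have hK0 : 0 ≤ K := Finset.sum_nonneg fun n _ => by positivity
    have hAK : ∀ n : ℕ, n * ‖A ^ n‖ ≤ K * r ^ n := fun n => by
      have hrn : 0 < r ^ n := pow_pos hr0 n
      by_cases hn : n < m
      · rw [← div_le_iff₀ hrn]
        exact Finset.single_le_sum (f := fun n : ℕ => n * ‖A ^ n‖ / r ^ n)
          (fun n _ => by positivity) (Finset.mem_range.2 hn)
      · rw [pow_eq_zero_of_le (not_lt.1 hn) hm, norm_zero, mul_zero]
        positivity
    -- the rate `r / 2` pays for the factor `n`
    have hr2 : ∀ n : ℕ, n * (r / 2) ^ n ≤ r ^ n := fun n => by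
      have h1 : (n : ℝ) ≤ 2 ^ n := by exact_mod_cast n.lt_two_pow_self.le
      rw [div_pow, ← mul_div_assoc, div_le_iff₀ (by positivity), mul_comm]
      gcongr
    obtain ⟨E, hE, hn⟩ := A.hasSplitPowerApprox (half_pos hr0) (ε / (K + 1)) (by positivity)
    refine ⟨E, hE.isDiagonalizableMatrix, fun _ n => ?_, fun h => absurd ⟨m, hm⟩ h⟩
    calc ‖(A + E) ^ n - A ^ n‖ ≤ ε / (K + 1) * n * (‖A ^ n‖ + (r / 2) ^ n) := hn n
      _ = ε / (K + 1) * (n * ‖A ^ n‖ + n * (r / 2) ^ n) := by ring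
      _ ≤ ε / (K + 1) * (K * r ^ n + r ^ n) :=
          mul_le_mul_of_nonneg_left (add_le_add (hAK n) (hr2 n)) (by positivity)
      _ = r ^ n * ε := by field_simp
  · obtain ⟨ρ, hρ, hρn⟩ := Matrix.exists_pos_pow_le_norm_pow hA
    obtain ⟨E, hE, hn⟩ := A.hasSplitPowerApprox hρ (ε / 2) (half_pos hε)
    refine ⟨E, hE.isDiagonalizableMatrix, fun h => absurd h hA, fun _ n => ?_⟩
    rw [div_le_iff₀ ((pow_pos hρ n).trans_le (hρn n))]
    calc ‖(A + E) ^ n - A ^ n‖ ≤ ε / 2 * n * (‖A ^ n‖ + ρ ^ n) := hn n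
      _ ≤ ε / 2 * n * (‖A ^ n‖ + ‖A ^ n‖) := by gcongr; exact hρn n
      _ = n * ε * ‖A ^ n‖ := by ring
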